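/- **Conventions.** An ai-semiring is a nonempty set $S$ with binary operations $+,\cdot$ such that $(S,+)$ is a commutative idempotent semigroup, $(S,\cdot)$ is a semigroup, and $x(y+z)=xy+xz$ and $(x+y)z=xz+yz$ hold. A variety is a class of ai-semirings closed under homomorphic images, subalgebras and arbitrary direct products (the empty product included); the subvarieties of a variety are ordered by inclusion. For a class $K$ of ai-semirings, $\mathsf V(K)$ is the smallest variety containing $K$. A variety is finitely based if, within the class of all ai-semirings, it is defined by finitely many identities; finitely generated if it is generated by finitely many finite algebras; and a Cross variety if it is finitely based, finitely generated and has only finitely many subvarieties. $\mathbf T$ is the trivial variety, consisting of all one-element ai-semirings. $R_2,N_2,T_2$ are the ai-semirings on $\{0,1\}$ with addition $\max$ and multiplication $xy=y$, $xy=0$, $xy=1$, respectively. $S_{56}$ is the ai-semiring on $\{1,2,3\}$ with Cayley tables $$\begin{array}{c|ccc}+&1&2&3\\\hline 1&1&1&3\\2&1&2&3\\3&3&3&3\end{array}\qquad\begin{array}{c|ccc}\cdot&1&2&3\\\hline 1&3&2&3\\2&3&2&3\\3&3&2&3\end{array}$$ **Corollary 2.9.** Let $\mathbf C$ be the variety of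 all ai-semirings satisfying the identity $yx\approx zx$. Then $\mathbf C$ is a Cross variety, and its subvariety lattice is a distributive lattice with exactly $10$ elements: $\mathbf T$, $\mathsf V(R_2)$, $\mathsf V(T_2)$, $\mathsf V(N_2)$, $\mathsf V(R_2,N_2)$, $\mathsf V(R_2,T_2)$, $\mathsf V(N_2,T_2)$, $\mathsf V(R_2,N_2,T_2)$, $\mathsf V(S_{56})$ and $\mathbf C$. Consequently, every subvariety of $\mathbf C$ is both finitely based and finitely generated. -/

import Mathlib

universe u

/-- Additively idempotent semirings (ai-semirings): a commutative idempotent additive semigroup and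
a multiplicative semigroup, linked by both distributive laws. No zero or one is required. -/
class AISemiring (S : Type u) extends AddCommSemigroup S, Semigroup S, Distrib S where
  protected add_idem : ∀ a : S, a + a = a

/-- A (nonempty) ai-semiring, bundled with its carrier. -/
structure AIAlg : Type (u + 1) where
  carrier : Type u
  [str : AISemiring carrier]
  [nonempty : Nonempty carrier]

namespace AIAlg

instance : CoeSort AIAlg.{u} (Type u) := ⟨AIAlg.carrier⟩

instance (A : AIAlg.{u}) : AISemiring A := A.str

instance (A : AIAlg.{u}) : Nonempty A := A.nonempty

/-- The direct product of a (possibly empty) family of ai-semirings. -/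
def pi {ι : Type u} (A : ι → AIAlg.{u}) : AIAlg.{u} where
  carrier := ∀ i, A i
  str :=
    { add := fun x y i => x i + y i
      mul := fun x y i => x i * y i
      add_assoc := fun _ _ _ => funext fun _ => add_assoc _ _ _
      add_comm := fun _ _ => funext fun _ => add_comm _ _
      mul_assoc := fun _ _ _ => funext fun _ => mul_assoc _ _ _
      left_distrib := fun _ _ _ => funext fun _ => mul_add _ _ _
      right_distrib := fun _ _ _ => funext fun _ => add_mul _ _ _
      add_idem := fun _ => funext fun _ => AISemiring.add_idem _ }
  nonempty := ⟨fun _ => Classical.arbitrary _⟩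

end AIAlg

/-- Homomorphisms of ai-semirings. -/
structure IsAIHom {A B : AIAlg.{u}} (f : A → B) : Prop where
  map_add : ∀ x y, f (x + y) = f x + f y
  map_mul : ∀ x y, f (x * y) = f x * f y

/-- Terms in the two binary operations over the countably infinite set of variables `x₀, x₁, …`. -/
inductive AITerm : Type
  | var : ℕ → AITerm
  | add : AITerm → AITerm → AITerm
  | mul : AITerm → AITerm → AITerm

/-- The value of a term under an assignment of the variables. -/
def AITerm.eval {A : AIAlg.{u}} (v : ℕ → A) : AITerm → A
  | .var n => v n
  | .add s t => s.eval v + t.eval v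
  | .mul s t => s.eval v * t.eval v

/-- An identity `lhs ≈ rhs`. -/
structure AIIdentity : Type where
  lhs : AITerm
  rhs : AITerm

/-- `A` satisfies the identity `e`. -/
def AIAlg.Satisfies (A : AIAlg.{u}) (e : AIIdentity) : Prop :=
  ∀ v : ℕ → A, e.lhs.eval v = e.rhs.eval v

/-- A variety of ai-semirings: a class of ai-semirings closed under homomorphic images,
subalgebras (and their isomorphic copies) and arbitrary direct products. -/
@[ext]
structure AIVariety : Type (u + 1) where
  carrier : Set AIAlg.{u}
  image_mem : ∀ {A B : AIAlg.{u}} (f : A → B), IsAIHom f → Function.Surjective f →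
    A ∈ carrier → B ∈ carrier
  sub_mem : ∀ {A B : AIAlg.{u}} (f : A → B), IsAIHom f → Function.Injective f →
    B ∈ carrier → A ∈ carrier
  pi_mem : ∀ {ι : Type u} (A : ι → AIAlg.{u}), (∀ i, A i ∈ carrier) → AIAlg.pi A ∈ carrier

theorem AITerm.eval_map {A B : AIAlg.{u}} {f : A → B} (hf : IsAIHom f) (v : ℕ → A) (t : AITerm) :
    f (t.eval v) = t.eval (fun n => f (v n)) := by
  induction t with
  | var n => rfl
  | add s t hs ht => simp only [AITerm.eval, hf.map_add, hs, ht]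
  | mul s t hs ht => simp only [AITerm.eval, hf.map_mul, hs, ht]

namespace AIVariety

/-- Varieties are ordered by inclusion. -/
instance : PartialOrder AIVariety.{u} :=
  PartialOrder.lift AIVariety.carrier fun _ _ h => AIVariety.ext h

/-- The intersection of a family of varieties. -/
instance : InfSet AIVariety.{u} where
  sInf s :=
    { carrier := {A | ∀ V ∈ s, A ∈ V.carrier}
      image_mem := fun f hf hs hA V hV => V.image_mem f hf hs (hA V hV)
      sub_mem := fun f hf hi hB V hV => V.sub_mem f hf hi (hB V hV)
      pi_mem := fun A hA V hV => V.pi_mem A fun i => hA i V hV }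

/-- The lattice of all varieties of ai-semirings, for which `V ≤ W` means that `V` is a subvariety
of `W`. Meets are intersections; joins are least upper bounds. -/
instance : CompleteLattice AIVariety.{u} :=
  completeLatticeOfInf AIVariety.{u} fun _ =>
    ⟨fun V hV _ hA => hA V hV, fun _ hW _ hA _ hV => hW hV hA⟩

/-- The variety `V(K)` generated by a class `K`: the least variety that contains `K`. -/
def generatedBy (K : Set AIAlg.{u}) : AIVariety.{u} := sInf {V | K ⊆ V.carrier}

/-- The variety defined by a set of identities. -/
def ofIdentities (E : Set AIIdentity) : AIVariety.{u} where
  carrier := {A | ∀ e ∈ E, A.Satisfies e}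
  image_mem := by
    intro A B f hf hs hA e he v
    choose g hg using hs
    have h := congrArg f (hA e he fun n => g (v n))
    simpa only [AITerm.eval_map hf, hg] using h
  sub_mem := by
    intro A B f hf hi hB e he v
    apply hi
    rw [AITerm.eval_map hf, AITerm.eval_map hf]
    exact hB e he _
  pi_mem := by
    intro ι A hA e he v
    funext i
    have hp : IsAIHom (A := AIAlg.pi A) (B := A i) (fun x => x i) :=
      ⟨fun _ _ => rfl, fun _ _ => rfl⟩
    exact (AITerm.eval_map hp v e.lhs).trans
      ((hA i e he _).trans (AITerm.eval_map hp v e.rhs).symm)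

/-- A variety is finitely based if finitely many identities define it. -/
def FinitelyBased (V : AIVariety.{u}) : Prop :=
  ∃ E : Set AIIdentity, E.Finite ∧ V = ofIdentities E

/-- A variety is finitely generated if finitely many finite algebras generate it. -/
def FinitelyGenerated (V : AIVariety.{u}) : Prop :=
  ∃ K : Set AIAlg.{u}, K.Finite ∧ (∀ A ∈ K, Finite A) ∧ V = generatedBy K

/-- A Cross variety is finitely based, finitely generated and has finitely many subvarieties. -/
def IsCross (V : AIVariety.{u}) : Prop :=
  V.FinitelyBased ∧ V.FinitelyGenerated ∧ (Set.Iic V).Finite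

/-- The trivial variety `T`, consisting of the one-element algebras. -/
def trivialVariety : AIVariety.{u} where
  carrier := {A | Subsingleton A}
  image_mem := fun {A _} _ _ hs hA =>
    have : Subsingleton A := hA
    hs.subsingleton
  sub_mem := fun {_ B} _ _ hi hB =>
    have : Subsingleton B := hB
    hi.subsingleton
  pi_mem := fun _ hA => ⟨fun _ _ => funext fun i => (hA i).elim _ _⟩

/-- The variety `C` of all ai-semirings that satisfy `y x ≈ z x`. -/
def varC : AIVariety.{u} :=
  ofIdentities {⟨.mul (.var 1) (.var 0), .mul (.var 2) (.var 0)⟩}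

end AIVariety

/-- The carrier `{0, 1}`. -/
inductive AITwo : Type u
  | e0
  | e1

namespace AITwo

/-- The common addition on `{0, 1}`, namely the maximum. -/
def sup : AITwo.{u} → AITwo.{u} → AITwo.{u}
  | e0, e0 => e0
  | e0, e1 => e1
  | e1, e0 => e1
  | e1, e1 => e1

end AITwo

namespace AIAlg

/-- `R₂`: the set `{0, 1}` with addition `max` and multiplication `x y = y`. -/
def R2 : AIAlg.{u} where
  carrier := AITwo.{u}
  str :=
    { add := AITwo.sup
      mul := fun _ y => y
      add_assoc := by rintro (_ | _) (_ | _) (_ | _) <;> rfl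
      add_comm := by rintro (_ | _) (_ | _) <;> rfl
      mul_assoc := fun _ _ _ => rfl
      left_distrib := fun _ _ _ => rfl
      right_distrib := by rintro (_ | _) (_ | _) (_ | _) <;> rfl
      add_idem := by rintro (_ | _) <;> rfl }
  nonempty := ⟨.e0⟩

/-- `N₂`: the set `{0, 1}` with addition `max` and multiplication `x y = 0`. -/
def N2 : AIAlg.{u} where
  carrier := AITwo.{u}
  str :=
    { add := AITwo.sup
      mul := fun _ _ => .e0
      add_assoc := by rintro (_ | _) (_ | _) (_ | _) <;> rfl
      add_comm := by rintro (_ | _) (_ | _) <;> rfl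
      mul_assoc := fun _ _ _ => rfl
      left_distrib := fun _ _ _ => rfl
      right_distrib := fun _ _ _ => rfl
      add_idem := by rintro (_ | _) <;> rfl }
  nonempty := ⟨.e0⟩

/-- `T₂`: the set `{0, 1}` with addition `max` and multiplication `x y = 1`. -/
def T2 : AIAlg.{u} where
  carrier := AITwo.{u}
  str :=
    { add := AITwo.sup
      mul := fun _ _ => .e1
      add_assoc := by rintro (_ | _) (_ | _) (_ | _) <;> rfl
      add_comm := by rintro (_ | _) (_ | _) <;> rfl
      mul_assoc := fun _ _ _ => rfl
      left_distrib := fun _ _ _ => rfl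
      right_distrib := fun _ _ _ => rfl
      add_idem := by rintro (_ | _) <;> rfl }
  nonempty := ⟨.e0⟩

end AIAlg

/-- The carrier `{1, 2, 3}`. -/
inductive AIThree : Type u
  | e1
  | e2
  | e3

namespace AIThree

/-- The addition of `S₅₆`, with rows `1 1 3`, `1 2 3` and `3 3 3`. -/
def add56 : AIThree.{u} → AIThree.{u} → AIThree.{u}
  | e1, e1 => e1
  | e1, e2 => e1
  | e1, e3 => e3
  | e2, e1 => e1
  | e2, e2 => e2
  | e2, e3 => e3
  | e3, e1 => e3
  | e3, e2 => e3
  | e3, e3 => e3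

/-- The multiplication of `S₅₆`, each of whose rows is `3 2 3`. -/
def mul56 : AIThree.{u} → AIThree.{u} → AIThree.{u}
  | _, e1 => e3
  | _, e2 => e2
  | _, e3 => e3

end AIThree

namespace AIAlg

/-- The three-element ai-semiring `S₅₆`. -/
def S56 : AIAlg.{u} where
  carrier := AIThree.{u}
  str :=
    { add := AIThree.add56
      mul := AIThree.mul56
      add_assoc := by rintro (_ | _ | _) (_ | _ | _) (_ | _ | _) <;> rfl
      add_comm := by rintro (_ | _ | _) (_ | _ | _) <;> rfl
      mul_assoc := by rintro (_ | _ | _) (_ | _ | _) (_ | _ | _) <;> rfl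
      left_distrib := by rintro (_ | _ | _) (_ | _ | _) (_ | _ | _) <;> rfl
      right_distrib := by rintro (_ | _ | _) (_ | _ | _) (_ | _ | _) <;> rfl
      add_idem := by rintro (_ | _ | _) <;> rfl }
  nonempty := ⟨.e1⟩

end AIAlg

/-! In an algebra of **C** the product `x y` is `φ y` for an idempotent additive endomorphism `φ`
(`mem_varC_iff`). Order the algebra by `x ≤ a` iff `x + a = a`, and let `χ` be the characteristic
function of the complement of a principal ideal. Then `x ↦ (χ x, χ (φ x))` is a homomorphism into
the four-element `square`, and such maps separate points (`exists_hom_square`). Hence the images in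
the square decide everything.

Each of R₂, N₂, T₂, S₅₆ violates its own identity `excl`, and any algebra of **C** that violates
this identity has the generator in its variety (`alg_mem_of_not_satisfies`). Conversely, the
identities that hold in an algebra restrict its images in the square so far that each is covered by
a product of generators that are not excluded (`mem_of_forall_alg_mem_or_satisfies`).

So a subvariety is determined by the generators it contains, and is axiomatized by `y x ≈ z x` and
the identities of the missing ones. Omitting a generator amounts to satisfying an identity, so joins
correspond to unions of sets of generators, as meets do to intersections; this gives distributivity.
The only constraint on these sets is that S₅₆ brings R₂ and T₂ with it, which leaves 8 + 2 = 10 of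
them. -/

theorem AIAlg.add_self (A : AIAlg.{u}) (a : A) : a + a = a := AISemiring.add_idem a

/-- Addition is the join for the order in which `x ≤ a` means `x + a = a`. -/
theorem AIAlg.add_add_eq_right_iff {A : AIAlg.{u}} {x y a : A} :
    x + y + a = a ↔ x + a = a ∧ y + a = a := by
  refine ⟨fun h => ⟨?_, ?_⟩, fun h => by rw [add_assoc, h.2, h.1]⟩
  · have : x + (x + y + a) = x + y + a := by simp only [← add_assoc, AIAlg.add_self]
    rwa [h] at this
  · have : y + (x + y + a) = x + y + a := by
      rw [add_comm x y]
      simp only [← add_assoc, AIAlg.add_self]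
    rwa [h] at this

/-! ### Constructions of algebras and criteria for membership in a variety. -/

namespace AIAlg

/-- The direct product of two ai-semirings. -/
def prod (A B : AIAlg.{u}) : AIAlg.{u} where
  carrier := A × B
  str :=
    { add := fun x y => (x.1 + y.1, x.2 + y.2)
      mul := fun x y => (x.1 * y.1, x.2 * y.2)
      add_assoc := fun _ _ _ => Prod.ext (add_assoc _ _ _) (add_assoc _ _ _)
      add_comm := fun _ _ => Prod.ext (add_comm _ _) (add_comm _ _)
      mul_assoc := fun _ _ _ => Prod.ext (mul_assoc _ _ _) (mul_assoc _ _ _)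
      left_distrib := fun _ _ _ => Prod.ext (mul_add _ _ _) (mul_add _ _ _)
      right_distrib := fun _ _ _ => Prod.ext (add_mul _ _ _) (add_mul _ _ _)
      add_idem := fun _ => Prod.ext (AISemiring.add_idem _) (AISemiring.add_idem _) }
  nonempty := ⟨(Classical.arbitrary _, Classical.arbitrary _)⟩

/-- The subalgebra of `A` on a nonempty subset closed under both operations. -/
def sub (A : AIAlg.{u}) (P : Set A) (hP : P.Nonempty)
    (hadd : ∀ {x y}, x ∈ P → y ∈ P → x + y ∈ P) (hmul : ∀ {x y}, x ∈ P → y ∈ P → x * y ∈ P) :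
    AIAlg.{u} where
  carrier := P
  str :=
    { add := fun x y => ⟨x.1 + y.1, hadd x.2 y.2⟩
      mul := fun x y => ⟨x.1 * y.1, hmul x.2 y.2⟩
      add_assoc := fun _ _ _ => Subtype.ext (add_assoc _ _ _)
      add_comm := fun _ _ => Subtype.ext (add_comm _ _)
      mul_assoc := fun _ _ _ => Subtype.ext (mul_assoc _ _ _)
      left_distrib := fun _ _ _ => Subtype.ext (mul_add _ _ _)
      right_distrib := fun _ _ _ => Subtype.ext (add_mul _ _ _)
      add_idem := fun _ => Subtype.ext (AISemiring.add_idem _) }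
  nonempty := hP.to_subtype

/-- The image of a homomorphism. -/
def range {A B : AIAlg.{u}} (f : A → B) (hf : IsAIHom f) : AIAlg.{u} :=
  B.sub (Set.range f) (Set.range_nonempty f)
    (by rintro _ _ ⟨x, rfl⟩ ⟨y, rfl⟩; exact ⟨x + y, hf.map_add x y⟩)
    (by rintro _ _ ⟨x, rfl⟩ ⟨y, rfl⟩; exact ⟨x * y, hf.map_mul x y⟩)

end AIAlg

namespace AIVariety

variable {V : AIVariety.{u}} {A B : AIAlg.{u}}

theorem prod_mem (hA : A ∈ V.carrier) (hB : B ∈ V.carrier) : A.prod B ∈ V.carrier := by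
  -- Index types of products live in `Type u`, hence the lift.
  let fam : ULift.{u} Bool → AIAlg.{u} := fun i => bif i.down then A else B
  refine V.sub_mem (B := AIAlg.pi fam) (fun x i => match i with
    | ⟨true⟩ => x.1
    | ⟨false⟩ => x.2) ⟨?_, ?_⟩ ?_ (V.pi_mem fam ?_)
  · exact fun x y => funext fun i => by rcases i with ⟨_ | _⟩ <;> rfl
  · exact fun x y => funext fun i => by rcases i with ⟨_ | _⟩ <;> rfl
  · exact fun x y h => Prod.ext (congrFun h ⟨true⟩) (congrFun h ⟨false⟩)
  · rintro ⟨_ | _⟩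
    exacts [hB, hA]

/-- A quotient of a subalgebra of a member, presented by the graph of the quotient map, is again
a member. -/
theorem mem_of_relation (hA : A ∈ V.carrier) (r : A → B → Prop)
    (hadd : ∀ {a b a' b'}, r a b → r a' b' → r (a + a') (b + b'))
    (hmul : ∀ {a b a' b'}, r a b → r a' b' → r (a * a') (b * b'))
    (hfun : ∀ {a b b'}, r a b → r a b' → b = b') (hsurj : ∀ b, ∃ a, r a b) :
    B ∈ V.carrier := by
  obtain ⟨b⟩ := B.nonempty
  obtain ⟨a, hab⟩ := hsurj b
  let G : AIAlg.{u} := (A.prod B).sub {p | r p.1 p.2} ⟨(a, b), hab⟩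
    (fun hx hy => hadd hx hy) (fun hx hy => hmul hx hy)
  have hG : G ∈ V.carrier := V.sub_mem (A := G) (fun p => p.1.1) ⟨fun _ _ => rfl, fun _ _ => rfl⟩
    (fun p q h => Subtype.ext (Prod.ext h (hfun p.2 ((show q.1.1 = p.1.1 from h.symm) ▸ q.2)))) hA
  exact V.image_mem (A := G) (fun p => p.1.2) ⟨fun _ _ => rfl, fun _ _ => rfl⟩
    (fun b => let ⟨a, h⟩ := hsurj b; ⟨⟨(a, b), h⟩, rfl⟩) hG

/-- The preimage under `g` of the image of `f` is a subalgebra of `B`, and `g` maps it onto that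
image. -/
theorem range_mem {D : AIAlg.{u}} (hB : B ∈ V.carrier) {f : A → D} (hf : IsAIHom f) {g : B → D}
    (hg : IsAIHom g) (hfg : ∀ x, ∃ y, g y = f x) : AIAlg.range f hf ∈ V.carrier := by
  refine mem_of_relation hB (fun b d => g b = d.1) ?_ ?_ ?_ ?_
  · intro a b a' b' h h'
    rw [hg.map_add, h, h']; rfl
  · intro a b a' b' h h'
    rw [hg.map_mul, h, h']; rfl
  · exact fun h h' => Subtype.ext (h.symm.trans h')
  · rintro ⟨_, x, rfl⟩
    exact hfg x

/-- Subdirect representation: `A` embeds in the product of its images in `D`, each of which is in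
`V` by `range_mem`. -/
theorem mem_of_separating {D : AIAlg.{u}}
    (hsep : ∀ x y : A, x ≠ y → ∃ f : A → D, IsAIHom f ∧ f x ≠ f y)
    (h : ∀ f : A → D, IsAIHom f →
      ∃ B ∈ V.carrier, ∃ g : B → D, IsAIHom g ∧ ∀ x, ∃ y, g y = f x) :
    A ∈ V.carrier := by
  let fam : {f : A → D // IsAIHom f} → AIAlg.{u} := fun f => AIAlg.range f.1 f.2
  refine V.sub_mem (B := AIAlg.pi fam) (fun x f => ⟨f.1 x, x, rfl⟩) ⟨?_, ?_⟩ ?_ (V.pi_mem fam ?_)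
  · exact fun x y => funext fun f => Subtype.ext (f.2.map_add x y)
  · exact fun x y => funext fun f => Subtype.ext (f.2.map_mul x y)
  · intro x y hxy
    by_contra hne
    obtain ⟨f, hf, hfne⟩ := hsep x y hne
    exact hfne (congrArg Subtype.val (congrFun hxy ⟨f, hf⟩))
  · rintro ⟨f, hf⟩
    obtain ⟨B, hB, g, hg, hfg⟩ := h f hf
    exact range_mem hB hf hg hfg

theorem exists_subsingleton_mem (V : AIVariety.{u}) : ∃ A ∈ V.carrier, Subsingleton A :=
  ⟨AIAlg.pi (ι := PEmpty.{u+1}) (fun i => i.elim), V.pi_mem _ (fun i => i.elim),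
    ⟨fun _ _ => funext fun i => i.elim⟩⟩

theorem generatedBy_le {K : Set AIAlg.{u}} : generatedBy K ≤ V ↔ K ⊆ V.carrier :=
  ⟨fun h _ hA => h fun _ hW => hW hA, fun h => sInf_le (a := V) h⟩

theorem subset_generatedBy (K : Set AIAlg.{u}) : K ⊆ (generatedBy K).carrier :=
  generatedBy_le.1 le_rfl

theorem mem_inf {V W : AIVariety.{u}} : A ∈ (V ⊓ W).carrier ↔ A ∈ V.carrier ∧ A ∈ W.carrier :=
  ⟨fun h => ⟨(inf_le_left : V ⊓ W ≤ V) h, (inf_le_right : V ⊓ W ≤ W) h⟩, fun h =>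
    (le_inf (generatedBy_le.2 (Set.singleton_subset_iff.2 h.1))
      (generatedBy_le.2 (Set.singleton_subset_iff.2 h.2)) : generatedBy {A} ≤ V ⊓ W)
      (subset_generatedBy _ rfl)⟩

/-- In a member of `C` the product `x y` is `φ y`, for an idempotent additive endomorphism `φ`. -/
theorem mem_varC_iff :
    A ∈ varC.carrier ↔ ∃ φ : A → A, (∀ x y, x * y = φ y) ∧ (∀ x, φ (φ x) = φ x) ∧
      ∀ x y, φ (x + y) = φ x + φ y := by
  constructor
  · intro h
    have key : ∀ x y : A, x * y = y * y := fun x y =>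
      -- The third variable also takes the value `y`, so `x y = y y` and `φ` can be squaring.
      h _ rfl fun n => match n with
        | 0 => y
        | 1 => x
        | _ => y
    refine ⟨fun x => x * x, key, fun x => ?_, fun x y => ?_⟩
    · change x * x * (x * x) = x * x
      rw [key (x * x) (x * x), ← mul_assoc, key (x * x * x) x]
    · change (x + y) * (x + y) = x * x + y * y
      rw [mul_add, key (x + y) x, key (x + y) y]
  · rintro ⟨φ, h, -⟩ _ rfl v
    exact (h _ _).trans (h _ _).symm

end AIVariety

/-- Indices for the four algebras that generate the subvarieties of `C`. -/
inductive AIGen : Type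
  | R
  | N
  | T
  | S

namespace AIGen

/-- The generating algebras. -/
def alg : AIGen → AIAlg.{u}
  | R => .R2
  | N => .N2
  | T => .T2
  | S => .S56

/-- For each generating algebra, the identity that characterizes, within `C`, the algebras
whose variety does not contain it. -/
def excl : AIGen → AIIdentity
  | R => ⟨.mul (.var 0) (.var 0), .mul (.var 1) (.var 1)⟩
  | N => ⟨.add (.var 0) (.mul (.var 0) (.var 0)), .mul (.var 0) (.var 0)⟩
  | T => ⟨.add (.var 0) (.mul (.var 0) (.var 0)), .var 0⟩
  | S => ⟨.add (.add (.var 0) (.mul (.var 0) (.var 0))) (.mul (.var 1) (.var 1)),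
      .add (.var 0) (.mul (.var 1) (.var 1))⟩

variable {A : AIAlg.{u}}

theorem satisfies_R : A.Satisfies (excl R) ↔ ∀ x y : A, x * x = y * y :=
  ⟨fun h x y => h fun | 0 => x | _ => y, fun h v => h (v 0) (v 1)⟩

theorem satisfies_N : A.Satisfies (excl N) ↔ ∀ x : A, x + x * x = x * x :=
  ⟨fun h x => h fun _ => x, fun h v => h (v 0)⟩

theorem satisfies_T : A.Satisfies (excl T) ↔ ∀ x : A, x + x * x = x :=
  ⟨fun h x => h fun _ => x, fun h v => h (v 0)⟩

theorem satisfies_S : A.Satisfies (excl S) ↔ ∀ x y : A, x + x * x + y * y = x + y * y :=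
  ⟨fun h x y => h fun | 0 => x | _ => y, fun h v => h (v 0) (v 1)⟩

end AIGen

/-! ### Extracting a generator from a violated identity. -/

namespace AIVariety

variable {V : AIVariety.{u}} {A : AIAlg.{u}}

section

variable {φ : A → A} (hmul : ∀ x y, x * y = φ y)
include hmul

/-- A two-element chain of fixed points of `φ` is a subalgebra isomorphic to R₂. -/
theorem R2_mem (hA : A ∈ V.carrier) {u v : A} (hu : φ u = u) (hv : φ v = v) (huv : u + v = v)
    (hne : u ≠ v) : AIAlg.R2 ∈ V.carrier := by
  refine mem_of_relation hA (fun a (b : AITwo) => match b with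
    | .e0 => a = u
    | .e1 => a = v) ?_ ?_ ?_ ?_
  · rintro a (_ | _) a' (_ | _) h h' <;>
      simp only at h h' <;> subst h <;> subst h'
    exacts [A.add_self _, huv, (add_comm _ _).trans huv, A.add_self _]
  · rintro a (_ | _) a' (_ | _) h h' <;> simp only at h h' <;> subst h'
    exacts [(hmul _ _).trans hu, (hmul _ _).trans hv, (hmul _ _).trans hu, (hmul _ _).trans hv]
  · rintro a (_ | _) (_ | _) h h' <;> simp only at h h' <;> first | rfl | skip
    exacts [(hne (h.symm.trans h')).elim, (hne (h'.symm.trans h)).elim]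
  · rintro (_ | _)
    exacts [⟨u, rfl⟩, ⟨v, rfl⟩]

/-- A two-element chain that `φ` sends to its lower element is a subalgebra isomorphic to N₂. -/
theorem N2_mem (hA : A ∈ V.carrier) {u v : A} (hu : φ u = u) (hv : φ v = u) (huv : u + v = v)
    (hne : u ≠ v) : AIAlg.N2 ∈ V.carrier := by
  refine mem_of_relation hA (fun a (b : AITwo) => match b with
    | .e0 => a = u
    | .e1 => a = v) ?_ ?_ ?_ ?_
  · rintro a (_ | _) a' (_ | _) h h' <;>
      simp only at h h' <;> subst h <;> subst h'
    exacts [A.add_self _, huv, (add_comm _ _).trans huv, A.add_self _]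
  · rintro a (_ | _) a' (_ | _) h h' <;> simp only at h h' <;> subst h'
    exacts [(hmul _ _).trans hu, (hmul _ _).trans hv, (hmul _ _).trans hu, (hmul _ _).trans hv]
  · rintro a (_ | _) (_ | _) h h' <;> simp only at h h' <;> first | rfl | skip
    exacts [(hne (h.symm.trans h')).elim, (hne (h'.symm.trans h)).elim]
  · rintro (_ | _)
    exacts [⟨u, rfl⟩, ⟨v, rfl⟩]

/-- Here `w` and `u + w` are identified. -/
theorem T2_mem (hA : A ∈ V.carrier) {u w : A} (hu : φ u = w) (hw : φ w = w)
    (hadd : φ (u + w) = w) (hne : u ≠ u + w) : AIAlg.T2 ∈ V.carrier := by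
  have hne' : u ≠ w := fun h => hne (h ▸ (A.add_self u).symm)
  have h1 : u + (u + w) = u + w := by rw [← add_assoc, A.add_self]
  have h2 : w + (u + w) = u + w := by rw [add_left_comm, A.add_self]
  refine mem_of_relation hA (fun a (b : AITwo) => match b with
    | .e0 => a = u
    | .e1 => a = w ∨ a = u + w) ?_ ?_ ?_ ?_
  · rintro a (_ | _) a' (_ | _) h h'
    · change a + a' = u
      rw [h, h', A.add_self]
    all_goals change a + a' = w ∨ a + a' = u + w
    · obtain rfl | rfl := h' <;> rw [h]
      exacts [.inr rfl, .inr h1]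
    · obtain rfl | rfl := h <;> rw [h', add_comm]
      exacts [.inr rfl, .inr h1]
    · obtain rfl | rfl := h <;> obtain rfl | rfl := h'
      exacts [.inl (A.add_self _), .inr h2, .inr ((add_comm _ _).trans h2), .inr (A.add_self _)]
  · intro a b a' b' _ h'
    refine .inl ((hmul _ _).trans ?_)
    rcases b' with _ | _
    · exact (congrArg φ h').trans hu
    · obtain rfl | rfl := h'
      exacts [hw, hadd]
  · rintro a (_ | _) (_ | _) h h'
    · rfl
    · obtain h' | h' := h'
      exacts [(hne' (h.symm.trans h')).elim, (hne (h.symm.trans h')).elim]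
    · obtain h | h := h
      exacts [(hne' (h'.symm.trans h)).elim, (hne (h'.symm.trans h)).elim]
    · rfl
  · rintro (_ | _)
    exacts [⟨u, rfl⟩, ⟨w, .inl rfl⟩]

/-- Here `w` and `u + w` are identified. -/
theorem S56_mem (hA : A ∈ V.carrier) {z u w : A} (hz : φ z = z) (hu : φ u = w) (hw : φ w = w)
    (hadd : φ (u + w) = w) (hzu : z + u = u) (hzw : z + w = w) (hne : u ≠ u + w) :
    AIAlg.S56 ∈ V.carrier := by
  have hne' : u ≠ w := fun h => hne (h ▸ (A.add_self u).symm)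
  have h1 : u + (u + w) = u + w := by rw [← add_assoc, A.add_self]
  have h2 : w + (u + w) = u + w := by rw [add_left_comm, A.add_self]
  have h3 : z + (u + w) = u + w := by rw [← add_assoc, hzu]
  have hzu' : z ≠ u := fun h => hne' (h ▸ hz ▸ h ▸ hu)
  have hzw' : z ≠ w := fun h => hne (by rw [← h, add_comm, hzu])
  have hzuw : z ≠ u + w := fun h => hzw' (by rw [← hz, h, hadd])
  refine mem_of_relation hA (fun a (b : AIThree) => match b with
    | .e1 => a = u
    | .e2 => a = z
    | .e3 => a = w ∨ a = u + w) ?_ ?_ ?_ ?_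
  -- The class `{w, u + w}` absorbs all four elements under addition, as `3` does in S₅₆.
  · have hA3 : ∀ a a' : A, (a = w ∨ a = u + w) → (a' = u ∨ a' = z ∨ a' = w ∨ a' = u + w) →
        (a + a' = w ∨ a + a' = u + w) := by
      rintro _ _ (rfl | rfl) (rfl | rfl | rfl | rfl)
      exacts [.inr (add_comm _ _), .inl ((add_comm _ _).trans hzw), .inl (A.add_self _), .inr h2,
        .inr ((add_comm _ _).trans h1), .inr ((add_comm _ _).trans h3),
        .inr ((add_comm _ _).trans h2), .inr (A.add_self _)]
    rintro a (_ | _ | _) a' (_ | _ | _) h h'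
    · exact (congrArg₂ _ h h').trans (A.add_self _)
    · exact (congrArg₂ _ h h').trans ((add_comm _ _).trans hzu)
    · exact add_comm a a' ▸ hA3 a' a h' (.inl h)
    · exact (congrArg₂ _ h h').trans hzu
    · exact (congrArg₂ _ h h').trans (A.add_self _)
    · exact add_comm a a' ▸ hA3 a' a h' (.inr (.inl h))
    · exact hA3 a a' h (.inl h')
    · exact hA3 a a' h (.inr (.inl h'))
    · exact hA3 a a' h (.inr (.inr h'))
  · rintro a b a' (_ | _ | _) - h'
    · exact .inl ((hmul _ _).trans ((congrArg φ h').trans hu))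
    · exact (hmul _ _).trans ((congrArg φ h').trans hz)
    · refine .inl ((hmul _ _).trans ?_)
      obtain rfl | rfl := h'
      exacts [hw, hadd]
  · rintro a (_ | _ | _) (_ | _ | _) h h' <;> first | rfl | exfalso
    · exact hzu' (h'.symm.trans h)
    · exact h'.elim (fun h' => hne' (h.symm.trans h')) fun h' => hne (h.symm.trans h')
    · exact hzu' (h.symm.trans h')
    · exact h'.elim (fun h' => hzw' (h.symm.trans h')) fun h' => hzuw (h.symm.trans h')
    · exact h.elim (fun h => hne' (h'.symm.trans h)) fun h => hne (h'.symm.trans h)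
    · exact h.elim (fun h => hzw' (h'.symm.trans h)) fun h => hzuw (h'.symm.trans h)
  · rintro (_ | _ | _)
    exacts [⟨u, rfl⟩, ⟨z, rfl⟩, ⟨w, .inl rfl⟩]

end

theorem alg_mem_of_not_satisfies (hV : V ≤ varC) (hA : A ∈ V.carrier) {g : AIGen}
    (h : ¬A.Satisfies g.excl) : g.alg ∈ V.carrier := by
  obtain ⟨φ, hmul, hφ, hadd⟩ := mem_varC_iff.1 (hV hA)
  cases g
  · simp only [AIGen.satisfies_R, hmul] at h
    push Not at h
    obtain ⟨x, y, hne⟩ := h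
    by_cases hx : φ x + φ y = φ x
    · exact R2_mem hmul hA (hφ y) (hφ x) ((add_comm _ _).trans hx) hne.symm
    · exact R2_mem hmul hA (hφ x) (v := φ x + φ y) (by rw [hadd, hφ, hφ])
        (by rw [← add_assoc, A.add_self]) (Ne.symm hx)
  · simp only [AIGen.satisfies_N, hmul] at h
    push Not at h
    obtain ⟨x, hne⟩ := h
    exact N2_mem hmul hA (hφ x) (v := x + φ x) (by rw [hadd, hφ, A.add_self])
      (by rw [add_left_comm, A.add_self]) hne.symm
  · simp only [AIGen.satisfies_T, hmul] at h
    push Not at h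
    obtain ⟨x, hne⟩ := h
    exact T2_mem hmul hA rfl (hφ x) (by rw [hadd, hφ, A.add_self]) hne.symm
  · simp only [AIGen.satisfies_S, hmul] at h
    push Not at h
    obtain ⟨x, y, hne⟩ := h
    have hw : φ (x + φ y) = φ x + φ y := by rw [hadd, hφ]
    have hw' : φ (φ x + φ y) = φ x + φ y := by rw [hadd, hφ, hφ]
    refine S56_mem hmul hA (hφ y) hw hw' ?_ ?_ ?_ ?_
    · rw [hadd, hw, hw', A.add_self]
    · rw [add_left_comm, A.add_self]
    · rw [add_left_comm, A.add_self]
    · intro h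
      apply hne
      conv_rhs => rw [h]
      rw [add_add_add_comm, A.add_self, add_assoc]

end AIVariety

/-! ### The square and homomorphisms into it. -/

namespace AIAlg

open AITwo

/-- The four-element algebra `{0, 1} × {0, 1}` with addition `max` and
`(a, b) (c, d) = (d, d)`, which generates `C`. -/
def square : AIAlg.{u} where
  carrier := AITwo.{u} × AITwo.{u}
  str :=
    { add := fun x y => (AITwo.sup x.1 y.1, AITwo.sup x.2 y.2)
      mul := fun _ y => (y.2, y.2)
      add_assoc := by rintro ⟨_ | _, _ | _⟩ ⟨_ | _, _ | _⟩ ⟨_ | _, _ | _⟩ <;> rfl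
      add_comm := by rintro ⟨_ | _, _ | _⟩ ⟨_ | _, _ | _⟩ <;> rfl
      mul_assoc := fun _ _ _ => rfl
      left_distrib := fun _ _ _ => rfl
      right_distrib := by rintro _ _ ⟨_ | _, _ | _⟩ <;> rfl
      add_idem := by rintro ⟨_ | _, _ | _⟩ <;> rfl }
  nonempty := ⟨(.e0, .e0)⟩

/-- The inclusion of `R₂`. -/
def R2Square : R2.{u} → square.{u} := fun x => (x, x)

theorem R2Square_hom : IsAIHom R2Square.{u} := ⟨fun _ _ => rfl, fun _ _ => rfl⟩

/-- The inclusion of `N₂`. -/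
def N2Square : N2.{u} → square.{u} := fun x => (x, e0)

theorem N2Square_hom : IsAIHom N2Square.{u} := ⟨fun _ _ => rfl, fun _ _ => rfl⟩

/-- The inclusion of `T₂`. -/
def T2Square : T2.{u} → square.{u} := fun x => (x, e1)

theorem T2Square_hom : IsAIHom T2Square.{u} := ⟨fun _ _ => rfl, fun _ _ => rfl⟩

/-- The inclusion of `S₅₆`. -/
def S56Square : S56.{u} → square.{u}
  | .e1 => (e0, e1)
  | .e2 => (e0, e0)
  | .e3 => (e1, e1)

theorem S56Square_hom : IsAIHom S56Square.{u} :=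
  ⟨by rintro (_ | _ | _) (_ | _ | _) <;> rfl, by rintro (_ | _ | _) (_ | _ | _) <;> rfl⟩

/-- A homomorphism from `R₂ × N₂` with image `{(0, 0), (1, 0), (1, 1)}`. -/
def R2N2Square : R2.{u}.prod N2.{u} → square.{u} := fun x => (AITwo.sup x.1 x.2, x.1)

theorem R2N2Square_hom : IsAIHom R2N2Square.{u} :=
  ⟨by rintro ⟨_ | _, _ | _⟩ ⟨_ | _, _ | _⟩ <;> rfl,
    by rintro ⟨_ | _, _ | _⟩ ⟨_ | _, _ | _⟩ <;> rfl⟩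

/-- A homomorphism from `S₅₆ × N₂` onto the square. -/
def S56N2Square : S56.{u}.prod N2.{u} → square.{u}
  | (.e1, n) => (n, e1)
  | (.e2, n) => (n, e0)
  | (.e3, _) => (e1, e1)

theorem S56N2Square_hom : IsAIHom S56N2Square.{u} :=
  ⟨by rintro ⟨_ | _ | _, _ | _⟩ ⟨_ | _ | _, _ | _⟩ <;> rfl,
    by rintro ⟨_ | _ | _, _ | _⟩ ⟨_ | _ | _, _ | _⟩ <;> rfl⟩

variable {A : AIAlg.{u}}

open Classical in
/-- The characteristic function of the complement of the principal ideal of `a`. -/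
noncomputable def notBelow (a x : A) : AITwo.{u} := if x + a = a then e0 else e1

theorem notBelow_add (a x y : A) :
    notBelow a (x + y) = AITwo.sup (notBelow a x) (notBelow a y) := by
  unfold notBelow
  by_cases hx : x + a = a <;> by_cases hy : y + a = a <;>
    simp [add_add_eq_right_iff, hx, hy, AITwo.sup]

/-- The second coordinate precomposes the first with `φ`; idempotence of `φ` makes the pair respect
products. If the maps for the ideals of `x` and of `y` both fail to separate these two points, then
`x ≤ y` and `y ≤ x`. -/
theorem exists_hom_square (hA : A ∈ AIVariety.varC.carrier) {x y : A} (hne : x ≠ y) :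
    ∃ f : A → square.{u}, IsAIHom f ∧ f x ≠ f y := by
  obtain ⟨φ, hmul, hφ, hadd⟩ := AIVariety.mem_varC_iff.1 hA
  have hom : ∀ a, IsAIHom (A := A) (B := square) fun x => (notBelow a x, notBelow a (φ x)) := by
    refine fun a => ⟨fun x y => ?_, fun x y => ?_⟩
    · exact Prod.ext (notBelow_add a x y) ((congrArg _ (hadd x y)).trans (notBelow_add a _ _))
    · rw [hmul, hφ]; rfl
  by_contra! h
  have key : ∀ x y : A, notBelow y x = notBelow y y → x + y = y := by
    intro x y h
    by_contra hxy
    simp [notBelow, hxy, A.add_self] at h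
  have h1 := key x y (congrArg Prod.fst (h _ (hom y)))
  have h2 := key y x (congrArg Prod.fst (h _ (hom x))).symm
  exact hne (by rw [← h1, add_comm, h2])

end AIAlg

/-! ### Recovering an algebra of **C** from the generators. -/

namespace AIVariety

open AITwo AIAlg

/-- The image of `A` in the square forces generators into `V`: a nonconstant second coordinate
forces R₂, the point `(1, 0)` forces N₂, the point `(0, 1)` forces T₂, and `(0, 1)` together with a
second coordinate `0` forces S₅₆. In each case the forced generators suffice to cover the image. -/
theorem mem_of_forall_alg_mem_or_satisfies {V : AIVariety.{u}} {A : AIAlg.{u}}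
    (hA : A ∈ varC.carrier) (h : ∀ g : AIGen, g.alg ∈ V.carrier ∨ A.Satisfies g.excl) :
    A ∈ V.carrier := by
  refine mem_of_separating (D := square) (fun x y hne => exists_hom_square hA hne) ?_
  intro f hf
  have hR : R2 ∈ V.carrier ∨ ∀ x y, (f x).2 = (f y).2 := (h .R).imp_right fun h x y => by
    have := congrArg f (AIGen.satisfies_R.1 h x y)
    rw [hf.map_mul, hf.map_mul] at this
    exact congrArg Prod.fst this
  have hN : N2 ∈ V.carrier ∨ ∀ x, f x ≠ (e1, e0) := (h .N).imp_right fun h x hx => by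
    have := congrArg f (AIGen.satisfies_N.1 h x)
    rw [hf.map_add, hf.map_mul, hx] at this
    cases this
  have hT : T2 ∈ V.carrier ∨ ∀ x, f x ≠ (e0, e1) := (h .T).imp_right fun h x hx => by
    have := congrArg f (AIGen.satisfies_T.1 h x)
    rw [hf.map_add, hf.map_mul, hx] at this
    cases this
  have hS : S56 ∈ V.carrier ∨ ∀ x, f x = (e0, e1) → ∀ y, (f y).2 = e1 :=
    (h .S).imp_right fun h x hx y => by
      have := congrArg f (AIGen.satisfies_S.1 h x y)
      simp only [hf.map_add, hf.map_mul, hx] at this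
      rcases hy : f y with ⟨_ | _, _ | _⟩ <;> rw [hy] at this <;> cases this
  clear h
  have two : ∀ a : AITwo.{u}, a = e0 ∨ a = e1 := by rintro (_ | _) <;> simp
  by_cases h01 : ∃ x, f x = (e0, e1)
  · obtain ⟨x, hx⟩ := h01
    have hTV : T2 ∈ V.carrier := hT.resolve_right fun h => h x hx
    by_cases hq : ∀ y, (f y).2 = e1
    · exact ⟨_, hTV, _, T2Square_hom, fun y => ⟨(f y).1, Prod.ext rfl (hq y).symm⟩⟩
    · have hSV : S56 ∈ V.carrier := hS.resolve_right fun h => hq (h x hx)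
      by_cases h10 : ∃ y, f y = (e1, e0)
      · obtain ⟨y, hy⟩ := h10
        have hNV : N2 ∈ V.carrier := hN.resolve_right fun h => h y hy
        refine ⟨_, prod_mem hSV hNV, _, S56N2Square_hom, fun z => ?_⟩
        rcases f z with ⟨_ | _, _ | _⟩
        exacts [⟨(.e2, .e0), rfl⟩, ⟨(.e1, .e0), rfl⟩, ⟨(.e2, .e1), rfl⟩, ⟨(.e3, .e0), rfl⟩]
      · refine ⟨_, hSV, _, S56Square_hom, fun z => ?_⟩
        rcases hz : f z with ⟨_ | _, _ | _⟩
        exacts [⟨.e2, rfl⟩, ⟨.e1, rfl⟩, (h10 ⟨z, hz⟩).elim, ⟨.e3, rfl⟩]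
  · by_cases hq : ∀ x y, (f x).2 = (f y).2
    · by_cases h10 : ∃ y, f y = (e1, e0)
      · obtain ⟨y, hy⟩ := h10
        have hNV : N2 ∈ V.carrier := hN.resolve_right fun h => h y hy
        exact ⟨_, hNV, _, N2Square_hom, fun z =>
          ⟨(f z).1, Prod.ext rfl ((congrArg Prod.snd hy).symm.trans (hq y z))⟩⟩
      -- The image is a single point of the diagonal, so the empty product covers it.
      · obtain ⟨B, hB, hsub⟩ := exists_subsingleton_mem V
        obtain ⟨x⟩ := A.nonempty
        refine ⟨B, hB, fun _ => ((f x).2, (f x).2), ⟨fun _ _ => (square.add_self _).symm,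
          fun _ _ => rfl⟩, fun y => ⟨Classical.arbitrary _, ?_⟩⟩
        rw [hq x y]
        rcases hy : f y with ⟨_ | _, _ | _⟩
        exacts [rfl, (h01 ⟨y, hy⟩).elim, (h10 ⟨y, hy⟩).elim, rfl]
    · have hRV : R2 ∈ V.carrier := hR.resolve_right hq
      by_cases h10 : ∃ y, f y = (e1, e0)
      · obtain ⟨y, hy⟩ := h10
        have hNV : N2 ∈ V.carrier := hN.resolve_right fun h => h y hy
        refine ⟨_, prod_mem hRV hNV, _, R2N2Square_hom, fun z => ?_⟩
        rcases hz : f z with ⟨_ | _, _ | _⟩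
        exacts [⟨(.e0, .e0), rfl⟩, (h01 ⟨z, hz⟩).elim, ⟨(.e0, .e1), rfl⟩, ⟨(.e1, .e0), rfl⟩]
      · refine ⟨_, hRV, _, R2Square_hom, fun z => ?_⟩
        rcases hz : f z with ⟨_ | _, _ | _⟩
        exacts [⟨.e0, rfl⟩, (h01 ⟨z, hz⟩).elim, (h10 ⟨z, hz⟩).elim, ⟨.e1, rfl⟩]

theorem le_iff_forall_alg_mem {V W : AIVariety.{u}} (hV : V ≤ varC) :
    V ≤ W ↔ ∀ g : AIGen, g.alg ∈ V.carrier → g.alg ∈ W.carrier := by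
  refine ⟨fun h g hg => h hg, fun h A hA => ?_⟩
  refine mem_of_forall_alg_mem_or_satisfies (hV hA) fun g => ?_
  by_cases hg : A.Satisfies g.excl
  exacts [.inr hg, .inl (h g (alg_mem_of_not_satisfies hV hA hg))]

theorem eq_of_alg_mem_iff {V W : AIVariety.{u}} (hV : V ≤ varC) (hW : W ≤ varC)
    (h : ∀ g : AIGen, g.alg ∈ V.carrier ↔ g.alg ∈ W.carrier) : V = W :=
  le_antisymm ((le_iff_forall_alg_mem hV).2 fun g => (h g).1)
    ((le_iff_forall_alg_mem hW).2 fun g => (h g).2)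

end AIVariety

/-! ### The lattice of subvarieties, bases and generators. -/

namespace AIVariety

open AITwo AIAlg AIGen

theorem alg_mem_varC (g : AIGen) : g.alg ∈ varC.{u}.carrier := by
  rw [mem_varC_iff]
  cases g
  · exact ⟨id, fun _ _ => rfl, fun _ => rfl, fun _ _ => rfl⟩
  · exact ⟨fun _ => AITwo.e0, fun _ _ => rfl, fun _ => rfl, fun _ _ => rfl⟩
  · exact ⟨fun _ => AITwo.e1, fun _ _ => rfl, fun _ => rfl, fun _ _ => rfl⟩
  · exact ⟨AIThree.mul56 .e1, by rintro (_ | _ | _) (_ | _ | _) <;> rfl,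
      by rintro (_ | _ | _) <;> rfl, by rintro (_ | _ | _) (_ | _ | _) <;> rfl⟩

/-- The negated disjunction describes when `g` lies in the variety generated by `h`: only S₅₆ yields
generators other than itself, namely R₂ and T₂. -/
theorem alg_satisfies_excl {g h : AIGen} (hgh : ¬(g = h ∨ h = .S ∧ (g = .R ∨ g = .T))) :
    h.alg.{u}.Satisfies g.excl := by
  cases g <;> cases h <;> simp at hgh <;>
    simp only [satisfies_R, satisfies_N, satisfies_T, satisfies_S]
  any_goals rintro (_ | _) (_ | _) <;> rfl
  any_goals rintro (_ | _) <;> rfl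

theorem not_alg_satisfies_excl {g h : AIGen} (hgh : g = h ∨ h = .S ∧ (g = .R ∨ g = .T)) :
    ¬h.alg.{u}.Satisfies g.excl := by
  rcases hgh with rfl | ⟨rfl, rfl | rfl⟩
  · cases g
    · rw [satisfies_R]; exact fun h => nomatch h AITwo.e0 AITwo.e1
    · rw [satisfies_N]; exact fun h => nomatch h AITwo.e1
    · rw [satisfies_T]; exact fun h => nomatch h AITwo.e0
    · rw [satisfies_S]; exact fun h => nomatch h AIThree.e1 AIThree.e2
  · rw [satisfies_R]; exact fun h => nomatch h AIThree.e1 AIThree.e2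
  · rw [satisfies_T]; exact fun h => nomatch h AIThree.e1

/-- Each generator splits the lattice below **C**: the subvarieties without it have a greatest
element, cut out by one identity. -/
theorem alg_not_mem_iff {V : AIVariety.{u}} (hV : V ≤ varC) {g : AIGen} :
    g.alg ∉ V.carrier ↔ V ≤ ofIdentities {g.excl} := by
  refine ⟨fun h A hA => ?_, fun h hg => not_alg_satisfies_excl (.inl rfl) (h hg _ rfl)⟩
  rintro _ rfl
  by_contra hn
  exact h (alg_mem_of_not_satisfies hV hA hn)

theorem generatedBy_alg_le (K : Set AIGen) : generatedBy (alg '' K) ≤ varC.{u} :=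
  generatedBy_le.2 (by rintro _ ⟨g, -, rfl⟩; exact alg_mem_varC g)

theorem alg_mem_generatedBy {K : Set AIGen} {g : AIGen} :
    g.alg ∈ (generatedBy (alg.{u} '' K)).carrier ↔
      ∃ h ∈ K, g = h ∨ h = .S ∧ (g = .R ∨ g = .T) := by
  constructor
  · intro hg
    by_contra! hK
    refine (alg_not_mem_iff (generatedBy_alg_le K)).2 (generatedBy_le.2 ?_) hg
    rintro _ ⟨h, hh, rfl⟩ _ rfl
    exact alg_satisfies_excl fun hgh => hgh.elim (hK h hh).1 fun hS =>
      hS.2.elim ((hK h hh).2 hS.1).1 ((hK h hh).2 hS.1).2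
  · rintro ⟨h, hh, hgh⟩
    exact alg_mem_of_not_satisfies (generatedBy_alg_le K)
      (subset_generatedBy _ (Set.mem_image_of_mem _ hh)) (not_alg_satisfies_excl hgh)

/-- A join lies below the subvariety that omits `g` iff both joinands do, so each generator is
join-prime. -/
theorem alg_mem_sup {V W : AIVariety.{u}} (hV : V ≤ varC) (hW : W ≤ varC) {g : AIGen} :
    g.alg ∈ (V ⊔ W).carrier ↔ g.alg ∈ V.carrier ∨ g.alg ∈ W.carrier := by
  rw [← not_iff_not, not_or, alg_not_mem_iff hV, alg_not_mem_iff hW,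
    alg_not_mem_iff (sup_le hV hW), sup_le_iff]

theorem inf_sup_of_le_varC {U V W : AIVariety.{u}} (hU : U ≤ varC) (hV : V ≤ varC)
    (hW : W ≤ varC) : U ⊓ (V ⊔ W) = U ⊓ V ⊔ U ⊓ W := by
  have hUV : U ⊓ V ≤ varC := inf_le_left.trans hU
  have hUW : U ⊓ W ≤ varC := inf_le_left.trans hU
  refine eq_of_alg_mem_iff (inf_le_left.trans hU) (sup_le hUV hUW) fun g => ?_
  rw [alg_mem_sup hUV hUW, mem_inf, alg_mem_sup hV hW, mem_inf, mem_inf, and_or_left]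

instance : Finite AIGen :=
  .of_surjective (α := Fin 4) (fun | 0 => .R | 1 => .N | 2 => .T | 3 => .S)
    (by rintro (_ | _ | _ | _); exacts [⟨0, rfl⟩, ⟨1, rfl⟩, ⟨2, rfl⟩, ⟨3, rfl⟩])

theorem eq_generatedBy_alg {V : AIVariety.{u}} (hV : V ≤ varC) :
    V = generatedBy (alg '' {g | g.alg ∈ V.carrier}) :=
  le_antisymm
    ((le_iff_forall_alg_mem hV).2 fun g hg => subset_generatedBy _ (Set.mem_image_of_mem _ hg))
    (generatedBy_le.2 (by rintro _ ⟨g, hg, rfl⟩; exact hg))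

theorem finitelyGenerated_of_le_varC {V : AIVariety.{u}} (hV : V ≤ varC) :
    V.FinitelyGenerated := by
  have h2 : Finite AITwo.{u} := .of_surjective (α := Bool) (fun b => bif b then .e0 else .e1)
    (by rintro (_ | _); exacts [⟨true, rfl⟩, ⟨false, rfl⟩])
  have h3 : Finite AIThree.{u} := .of_surjective (α := Fin 3) (fun | 0 => .e1 | 1 => .e2 | 2 => .e3)
    (by rintro (_ | _ | _); exacts [⟨0, rfl⟩, ⟨1, rfl⟩, ⟨2, rfl⟩])
  refine ⟨_, (Set.toFinite _).image alg, ?_, eq_generatedBy_alg hV⟩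
  rintro _ ⟨g, -, rfl⟩
  cases g
  exacts [h2, h2, h2, h3]

theorem finitelyBased_of_le_varC {V : AIVariety.{u}} (hV : V ≤ varC) : V.FinitelyBased := by
  refine ⟨insert ⟨.mul (.var 1) (.var 0), .mul (.var 2) (.var 0)⟩
    (excl '' {g | g.alg ∉ V.carrier}), ((Set.toFinite _).image _).insert _,
    le_antisymm ?_ fun A hA => ?_⟩
  · rintro A hA _ (rfl | ⟨g, hg, rfl⟩)
    exacts [hV hA _ rfl, (alg_not_mem_iff hV).1 hg hA _ rfl]
  · refine mem_of_forall_alg_mem_or_satisfies (fun e he => hA e (.inl he)) fun g => ?_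
    exact or_iff_not_imp_left.2 fun hg => hA _ (.inr ⟨g, hg, rfl⟩)

theorem trivialVariety_eq : trivialVariety = generatedBy (alg.{u} '' ∅) := by
  have h : trivialVariety ≤ varC.{u} := by
    rintro A hA _ - v
    exact (hA : Subsingleton A).elim _ _
  refine eq_of_alg_mem_iff h (generatedBy_alg_le _) fun g => ?_
  rw [alg_mem_generatedBy]
  -- A one-element algebra satisfies every identity, whereas each generator violates its own.
  refine iff_of_false (fun hg => not_alg_satisfies_excl (g := g) (.inl rfl) fun v => ?_) (by simp)
  exact (hg : Subsingleton g.alg).elim _ _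

theorem varC_eq : varC = generatedBy (alg.{u} '' {.S, .N}) := by
  refine eq_of_alg_mem_iff le_rfl (generatedBy_alg_le _) fun g => ?_
  rw [alg_mem_generatedBy]
  refine iff_of_true (alg_mem_varC g) ?_
  cases g <;> simp

open Classical in
/-- Which of the four generating algebras lie in `V`. -/
noncomputable def gens (V : AIVariety.{u}) : Bool × Bool × Bool × Bool :=
  (R2 ∈ V.carrier, N2 ∈ V.carrier, T2 ∈ V.carrier, S56 ∈ V.carrier)

theorem gens_injOn : Set.InjOn gens (Set.Iic varC.{u}) := by
  intro V hV W hW h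
  simp only [gens, Prod.mk.injEq, decide_eq_decide] at h
  refine eq_of_alg_mem_iff hV hW fun g => ?_
  cases g
  exacts [h.1, h.2.1, h.2.2.1, h.2.2.2]

open Classical in
theorem gens_generatedBy (K : Set AIGen) : gens (generatedBy (alg.{u} '' K)) =
    (decide (.R ∈ K ∨ .S ∈ K), decide (.N ∈ K), decide (.T ∈ K ∨ .S ∈ K), decide (.S ∈ K)) := by
  have h (g : AIGen) := alg_mem_generatedBy.{u} (K := K) (g := g)
  simp only [gens, Prod.mk.injEq, decide_eq_decide]
  refine ⟨(h .R).trans ?_, (h .N).trans ?_, (h .T).trans ?_, (h .S).trans ?_⟩ <;>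
    simp [and_or_left, exists_or]

/-- The ten varieties of the list. -/
abbrev subvarieties : Set AIVariety.{u} :=
  {trivialVariety, generatedBy {R2}, generatedBy {T2}, generatedBy {N2}, generatedBy {R2, N2},
    generatedBy {R2, T2}, generatedBy {N2, T2}, generatedBy {R2, N2, T2}, generatedBy {S56}, varC}

theorem subvarieties_eq : subvarieties.{u} = (fun K => generatedBy (alg '' K)) ''
    {∅, {R}, {T}, {N}, {R, N}, {R, T}, {N, T}, {R, N, T}, {S}, {S, N}} := by
  simp only [subvarieties, Set.image_insert_eq, Set.image_singleton, trivialVariety_eq, varC_eq]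
  rfl

theorem gens_image_subvarieties : gens '' subvarieties.{u} =
    (({(false, false, false, false), (true, false, false, false), (false, false, true, false),
      (false, true, false, false), (true, true, false, false), (true, false, true, false),
      (false, true, true, false), (true, true, true, false), (true, false, true, true),
      (true, true, true, true)} : Finset (Bool × Bool × Bool × Bool)) : Set _) := by
  rw [subvarieties_eq, Set.image_image]
  simp only [gens_generatedBy, Set.image_insert_eq, Set.image_singleton]
  simp

/-- Since S₅₆ brings R₂ and T₂, only ten of the sixteen membership patterns can occur, and the
listed varieties realize all ten. -/
theorem Iic_varC : Set.Iic varC.{u} = subvarieties := by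
  have hsub : subvarieties ⊆ Set.Iic varC.{u} := by
    rw [subvarieties_eq]
    rintro _ ⟨K, -, rfl⟩
    exact generatedBy_alg_le K
  refine Set.Subset.antisymm (fun V hV => ?_) hsub
  have hS (hVS : S56 ∈ V.carrier) (g : AIGen) (hg : g = R ∨ g = T) : g.alg ∈ V.carrier :=
    alg_mem_of_not_satisfies hV (g := g) (A := alg S) hVS (not_alg_satisfies_excl (.inr ⟨rfl, hg⟩))
  have hR (hVS : S56 ∈ V.carrier) : R2 ∈ V.carrier := hS hVS R (.inl rfl)
  have hT (hVS : S56 ∈ V.carrier) : T2 ∈ V.carrier := hS hVS T (.inr rfl)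
  have hmem : gens V ∈ gens '' subvarieties := by
    rw [gens_image_subvarieties]
    by_cases h1 : R2 ∈ V.carrier <;> by_cases h2 : N2 ∈ V.carrier <;>
      by_cases h3 : T2 ∈ V.carrier <;> by_cases h4 : S56 ∈ V.carrier <;>
      simp [gens, h1, h2, h3, h4] <;> tauto
  obtain ⟨W, hW, hWV⟩ := hmem
  exact gens_injOn (hsub hW) hV hWV ▸ hW

theorem ncard_Iic_varC : (Set.Iic varC.{u}).ncard = 10 := by
  rw [← gens_injOn.ncard_image, Iic_varC, gens_image_subvarieties,
    Set.ncard_coe_finset]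
  decide

end AIVariety

theorem corollary2p9 :
    AIVariety.varC.{u}.IsCross ∧
    (∀ U V W : Set.Iic AIVariety.varC.{u}, U ⊓ (V ⊔ W) = (U ⊓ V) ⊔ (U ⊓ W)) ∧
    Set.Iic AIVariety.varC.{u} =
      {AIVariety.trivialVariety,
        AIVariety.generatedBy {AIAlg.R2},
        AIVariety.generatedBy {AIAlg.T2},
        AIVariety.generatedBy {AIAlg.N2},
        AIVariety.generatedBy {AIAlg.R2, AIAlg.N2},
        AIVariety.generatedBy {AIAlg.R2, AIAlg.T2},
        AIVariety.generatedBy {AIAlg.N2, AIAlg.T2},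
        AIVariety.generatedBy {AIAlg.R2, AIAlg.N2, AIAlg.T2},
        AIVariety.generatedBy {AIAlg.S56},
        AIVariety.varC} ∧
    (Set.Iic AIVariety.varC.{u}).ncard = 10 ∧
    ∀ V : AIVariety.{u}, V ≤ AIVariety.varC → V.FinitelyBased ∧ V.FinitelyGenerated :=
  ⟨⟨AIVariety.finitelyBased_of_le_varC le_rfl, AIVariety.finitelyGenerated_of_le_varC le_rfl,
      Set.finite_of_ncard_ne_zero (by rw [AIVariety.ncard_Iic_varC]; decide)⟩,
    fun U V W => Subtype.ext (AIVariety.inf_sup_of_le_varC U.2 V.2 W.2),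
    AIVariety.Iic_varC, AIVariety.ncard_Iic_varC,
    fun _ hV => ⟨AIVariety.finitelyBased_of_le_varC hV,
      AIVariety.finitelyGenerated_of_le_varC hV⟩⟩
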